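/- All Banach spaces are over a fixed scalar field $\mathbb K\in\{\mathbb R,\mathbb C\}$, operators are bounded and linear, and subspaces are closed. An operator $S\colon W\to Z$ *factors through* $T\colon X\to Y$ if $S=VTU$ for some operators $U\colon W\to X$, $V\colon Y\to Z$. For a class $\mathscr C$ of operators between Banach spaces, $\Upsilon$ is *universal for* $\mathscr C$ if $\Upsilon\in\mathscr C$ and $\Upsilon$ factors through every member of $\mathscr C$. Let $\mathscr X^*$ be the class of operators $T$ whose adjoint $T^*$ has norm-separable range, and $\complement\mathscr X^*$ its complement. An operator $T\colon X\to Y$ is *Asplund* if $T|_Z\in\mathscr X^*$ for every separable subspace $Z\subseteq X$. Let $\Omega$ be the set of all finite (possibly empty) sequences of natural numbers, ordered by $s\sqsubseteq t$ iff $s$ is an initial segment of $t$, and let $\mathcal D\subseteq\Omega$ be the infinite dyadic tree of finite sequences in $\{0,1\}$. For a downwards closed $\mathcal T\subseteq\Omega$ let $\partial\mathcal T$ be the set of infinite branches (infinite maximal chains) of $\mathcal T$ and $\overline{\mathcal T}=\mathcal T\cup\partial\mathcal T$, ordered by $\sqsubseteq'$, which extends $\sqsubseteq$ on $\mathcal T$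 by: $s\sqsubseteq' b$ iff $s\in b$ or $s=b$, for $b\in\partial\mathcal T$. Give $\overline{\mathcal T}$ its coarse wedge topology, whose subbase consists of the sets $\{s\in\overline{\mathcal T}: t\sqsubseteq' s\}$ and their complements, where $t$ ranges over the elements of $\overline{\mathcal T}$ whose set of strict predecessors is empty or has a greatest element; it is compact. Define $$\Sigma_{\mathcal T}\colon\ell_1(\mathcal T)\to\ell_\infty(\mathcal T),\quad (\Sigma_{\mathcal T}x)(t)=\sum_{s\sqsubseteq t}x(s),\qquad \sigma_{\mathcal T}\colon\ell_1(\mathcal T)\to C(\overline{\mathcal T}),\quad (\sigma_{\mathcal T}x)(t)=\sum_{s\in\mathcal T,\ s\sqsubseteq' t}x(s).$$ **Theorem.** Let $X,Y$ be Banach spaces, $T\colon X\to Y$ an operator such that $T^*(Y^*)$ is non-separable, and $\mathcal T\subseteq\Omega$ downwards closed. 1. If $X$ is separable, then $\Sigma_{\mathcal T}$ factors through $T$. 2. If $Y$ is separable, then $\sigma_{\mathcal T}$ factors through $T$, and hence so does $\Sigma_{\mathcal T}$. If $\mathcal S\subseteq\Omega$ is downwards closed and $\partial\mathcal S$ is uncountable,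 then: 3. $\Sigma_{\mathcal S}$ is universal for the class of non-Asplund operators. 4. $\sigma_{\mathcal S}$ is universal for the class of operators in $\complement\mathscr X^*$ having separable codomain, and this class coincides with the class of non-Asplund operators having separable codomain. In particular, $\partial\mathcal S$ is uncountable and (3) and (4) hold for $\mathcal S=\Omega$ and for $\mathcal S=\mathcal D$. -/

import Mathlib

open scoped ENNReal

universe w u v u₁ v₁

namespace TreeOperators


/-! ### Trees of finite sequences -/

/-- The set of all finite (possibly empty) sequences of natural numbers. -/
def Omega : Type := List ℕ

/-- `s ≤ t` means that `s` is an initial segment of `t`. -/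
instance : PartialOrder Omega where
  le s t := List.IsPrefix s t
  le_refl s := List.prefix_refl s
  le_trans _ _ _ h₁ h₂ := List.IsPrefix.trans h₁ h₂
  le_antisymm _ _ h₁ h₂ := h₁.eq_of_length (le_antisymm h₁.length_le h₂.length_le)

theorem Omega.le_def {s t : Omega} : s ≤ t ↔ List.IsPrefix s t := Iff.rfl

theorem Omega.total_of_le {s t u : Omega} (hs : s ≤ u) (ht : t ≤ u) : s ≤ t ∨ t ≤ s :=
  List.prefix_or_prefix_of_prefix hs ht

theorem Omega.finite_Iic (t : Omega) : (Set.Iic t).Finite :=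
  (List.finite_toSet (List.inits t)).subset fun _ hs => (List.mem_inits _ _).2 hs

/-- The infinite dyadic tree: all finite sequences in `{0, 1}`. -/
def dyadicTree : LowerSet Omega where
  carrier := {t | ∀ n ∈ (show List ℕ from t), n = 0 ∨ n = 1}
  lower' := fun _ _ hst ht n hn => ht n (List.IsPrefix.subset hst hn)

/-- The set of all infinite branches (infinite maximal chains) of a downwards closed tree. -/
def boundary (T : LowerSet Omega) : Set (Set T) :=
  {b | IsMaxChain (· ≤ ·) b ∧ b.Infinite}

theorem boundary.mem_of_le {T : LowerSet Omega} {b : Set T} (hb : b ∈ boundary T) {s t : T}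
    (hst : s ≤ t) (ht : t ∈ b) : s ∈ b := by
  have hc : IsChain (· ≤ ·) (insert s b) := by
    refine hb.1.1.insert fun c hc _ => ?_
    rcases hb.1.1.total ht hc with h | h
    · exact Or.inl (hst.trans h)
    · exact Omega.total_of_le (u := (t : Omega)) hst h
  rw [hb.1.2 hc (Set.subset_insert s b)]
  exact Set.mem_insert s b

/-- The union of a downwards closed tree with its set of infinite branches. -/
inductive Completion (T : LowerSet Omega) : Type
  | node (t : T) : Completion T
  | branch (b : boundary T) : Completion T

namespace Completion

variable {T : LowerSet Omega}

/-- The extended order: nodes are compared as in the tree, a node lies below a branch when it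
belongs to it, and distinct branches are incomparable. -/
protected def le : Completion T → Completion T → Prop
  | node s, node t => s ≤ t
  | node s, branch b => s ∈ b.1
  | branch _, node _ => False
  | branch b, branch c => b = c

instance : PartialOrder (Completion T) where
  le := Completion.le
  le_refl a := by cases a <;> simp [Completion.le]
  le_trans a b c hab hbc := by
    cases a <;> cases b <;> cases c <;> simp only [Completion.le] at hab hbc ⊢
    · exact hab.trans hbc
    · exact boundary.mem_of_le (Subtype.property _) hab hbc
    · exact hbc ▸ hab
    · exact hab.trans hbc
  le_antisymm a b hab hba := by
    cases a <;> cases b <;> simp only [Completion.le] at hab hba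
    · rw [le_antisymm hab hba]
    · rw [hab]

@[simp] theorem node_le_node {s t : T} : node s ≤ node t ↔ s ≤ t := Iff.rfl

@[simp] theorem node_le_branch {s : T} {b : boundary T} : node s ≤ branch b ↔ s ∈ b.1 := Iff.rfl

@[simp] theorem not_branch_le_node {s : T} {b : boundary T} : ¬ branch b ≤ node s := fun h => h

@[simp] theorem branch_le_branch {b c : boundary T} : branch b ≤ branch c ↔ b = c := Iff.rfl

end Completion

/-! ### The coarse wedge topology -/

/-- The set of predecessors of `t` is empty or has a greatest element; in a tree this says that
its order type is `0` or a successor ordinal. -/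
def IsNonLimit {α : Type*} [PartialOrder α] (t : α) : Prop :=
  Set.Iio t = ∅ ∨ ∃ p, IsGreatest (Set.Iio t) p

/-- The coarse wedge topology, with subbase the sets `{s | t ≤ s}` and their complements, `t` non-limit. -/
@[reducible] def coarseWedge (α : Type*) [PartialOrder α] : TopologicalSpace α :=
  TopologicalSpace.generateFrom
    {U | ∃ t : α, IsNonLimit t ∧ (U = Set.Ici t ∨ U = (Set.Ici t)ᶜ)}

namespace Completion

variable {T : LowerSet Omega}

instance : TopologicalSpace (Completion T) := coarseWedge (Completion T)

theorem isNonLimit_node (t : T) : IsNonLimit (node t) := by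
  by_cases h : Set.Iio (node t) = ∅
  · exact Or.inl h
  right
  have hfin : {s : T | s < t}.Finite :=
    ((Omega.finite_Iic (t : Omega)).preimage Subtype.val_injective.injOn).subset
      fun s hs => (le_of_lt hs : s ≤ t)
  have key : ∀ a : Completion T, a < node t → ∃ s : T, a = node s ∧ s < t := by
    intro a ha
    cases a with
    | node s => exact ⟨s, rfl, ⟨ha.1, ha.2⟩⟩
    | branch b => exact absurd ha.1 not_branch_le_node
  obtain ⟨a, ha⟩ := Set.nonempty_iff_ne_empty.2 h
  obtain ⟨s, -, hs⟩ := key a ha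
  obtain ⟨m, hm⟩ := hfin.exists_maximal ⟨s, hs⟩
  refine ⟨node m, ⟨hm.prop.1, hm.prop.2⟩, fun a ha => ?_⟩
  obtain ⟨c, rfl, hc⟩ := key a ha
  rcases Omega.total_of_le (u := (t : Omega)) hc.le hm.prop.le with h | h
  · exact h
  · exact hm.le_of_ge hc h

theorem isNonLimit_iff (a : Completion T) : IsNonLimit a ↔ ∃ t, a = node t := by
  refine ⟨fun h => ?_, fun ⟨t, ht⟩ => ht ▸ isNonLimit_node t⟩
  cases a with
  | node t => exact ⟨t, rfl⟩
  | branch b =>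
    exfalso
    have hlt : ∀ s ∈ b.1, node s < branch b := fun s hs => ⟨hs, not_branch_le_node⟩
    rcases h with h | ⟨p, hp, hmax⟩
    · obtain ⟨s, hs⟩ := b.2.2.nonempty
      exact (Set.eq_empty_iff_forall_notMem.1 h) (node s) (hlt s hs)
    · cases p with
      | branch c => exact hp.2 (le_of_eq (congrArg branch (hp.1 : c = b).symm))
      | node p =>
        refine b.2.2 (((Omega.finite_Iic (p : Omega)).preimage
          Subtype.val_injective.injOn).subset fun s hs => ?_)
        exact (hmax (hlt s hs) : node s ≤ node p)

theorem isClopen_Ici_node (t : T) : IsClopen (Set.Ici (node t)) := by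
  constructor
  · rw [← isOpen_compl_iff]
    exact TopologicalSpace.isOpen_generateFrom_of_mem ⟨_, isNonLimit_node t, Or.inr rfl⟩
  · exact TopologicalSpace.isOpen_generateFrom_of_mem ⟨_, isNonLimit_node t, Or.inl rfl⟩

theorem le_nhds_of_forall (f : Ultrafilter (Completion T)) (a : Completion T)
    (h : ∀ s : T, node s ≤ a ↔ Set.Ici (node s) ∈ f) : (f : Filter (Completion T)) ≤ nhds a := by
  refine le_of_le_of_eq ?_ TopologicalSpace.nhds_generateFrom.symm
  refine le_iInf₂ fun U hU => ?_
  obtain ⟨haU, t, ht, hU⟩ := hU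
  obtain ⟨t, rfl⟩ := (isNonLimit_iff t).1 ht
  rw [Filter.le_principal_iff]
  rcases hU with rfl | rfl
  · exact (h t).1 haU
  · exact Ultrafilter.compl_mem_iff_notMem.2 fun hf => haU ((h t).2 hf)

instance : CompactSpace (Completion T) := by
  refine ⟨isCompact_iff_ultrafilter_le_nhds.2 fun f _ => ?_⟩
  let A : Set T := {s | Set.Ici (node s) ∈ f}
  have hAlow : ∀ s t : T, s ≤ t → t ∈ A → s ∈ A := fun s t hst ht =>
    Filter.mem_of_superset ht (Set.Ici_subset_Ici.2 hst)
  have hAchain : IsChain (· ≤ ·) A := by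
    intro s hs t ht _
    obtain ⟨a, has, hat⟩ := Filter.nonempty_of_mem (Filter.inter_mem hs ht)
    cases a with
    | node a => exact Omega.total_of_le (u := (a : Omega)) has hat
    | branch b => exact b.2.1.1.total has hat
  by_cases hfin : A.Finite
  · have hne : A.Nonempty := by
      obtain ⟨a, -⟩ := Filter.nonempty_of_mem (f := (f : Filter (Completion T))) Filter.univ_mem
      have hT : ∃ t : T, True := by
        cases a with
        | node t => exact ⟨t, trivial⟩
        | branch b => exact ⟨b.2.2.nonempty.some, trivial⟩
      obtain ⟨t, -⟩ := hT
      have hroot : (show Omega from ([] : List ℕ)) ∈ T :=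
        T.lower (show (show Omega from ([] : List ℕ)) ≤ t from List.nil_prefix) t.2
      refine ⟨⟨_, hroot⟩, Filter.mem_of_superset Filter.univ_mem fun c _ => ?_⟩
      have hle : ∀ c : T, (⟨_, hroot⟩ : T) ≤ c := fun c => List.nil_prefix
      cases c with
      | node c => exact hle c
      | branch b => exact boundary.mem_of_le b.2 (hle _) b.2.2.nonempty.some_mem
    obtain ⟨m, hm⟩ := hfin.exists_maximal hne
    refine ⟨node m, trivial, le_nhds_of_forall f _ fun s => ⟨fun h => hAlow s m h hm.prop,
      fun h => ?_⟩⟩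
    rcases hAchain.total h hm.prop with h' | h'
    · exact h'
    · exact hm.le_of_ge h h'
  · have hbr : A ∈ boundary T := by
      refine ⟨⟨hAchain, fun C hC hAC => hAC.antisymm fun c hc => ?_⟩, hfin⟩
      by_contra hcA
      refine hfin (((Omega.finite_Iic (c : Omega)).preimage
        Subtype.val_injective.injOn).subset fun s hs => ?_)
      rcases hC.total (hAC hs) hc with h | h
      · exact h
      · exact absurd (hAlow c s h hs) hcA
    exact ⟨branch ⟨A, hbr⟩, trivial, le_nhds_of_forall f _ fun s => Iff.rfl⟩

end Completion

/-! ### The summation operators -/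

section Operators

variable (𝕜 : Type w) [RCLike 𝕜]

/-- `ℓ₁(I)`. -/
abbrev EllOne (I : Type*) := lp (fun _ : I => 𝕜) 1

/-- `ℓ_∞(I)`. -/
abbrev EllInfty (I : Type*) := lp (fun _ : I => 𝕜) ∞

variable {𝕜}

theorem EllOne.summable_norm {I : Type*} (x : EllOne 𝕜 I) : Summable fun i => ‖x i‖ := by
  simpa using (lp.memℓp x).summable (by simp)

theorem EllOne.summable_subtype {I : Type*} (x : EllOne 𝕜 I) (A : Set I) :
    Summable fun i : A => x i :=
  ((EllOne.summable_norm x).subtype A).of_norm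

theorem EllOne.norm_tsum_le {I : Type*} (x : EllOne 𝕜 I) (A : Set I) :
    ‖∑' i : A, x i‖ ≤ ‖x‖ := by
  have h : ‖x‖ = ∑' i, ‖x i‖ := by
    simpa using lp.norm_eq_tsum_rpow (p := 1) (by simp) x
  rw [h]
  exact (norm_tsum_le_tsum_norm ((EllOne.summable_norm x).subtype A)).trans
    (Summable.tsum_subtype_le (fun i => ‖x i‖) A (fun i => norm_nonneg _)
      (EllOne.summable_norm x))

variable (𝕜)

/-- The operator `ℓ₁(α) → ℓ_∞(α)`, `x ↦ (∑_{s ≤ t} x s)_t`. -/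
noncomputable def bigSigma (α : Type*) [PartialOrder α] : EllOne 𝕜 α →L[𝕜] EllInfty 𝕜 α :=
  LinearMap.mkContinuous
    { toFun := fun x => ⟨fun t => ∑' s : Set.Iic t, x s, memℓp_infty
        ⟨‖x‖, by rintro _ ⟨t, rfl⟩; exact EllOne.norm_tsum_le x _⟩⟩
      map_add' := fun x y => by
        ext t
        exact (EllOne.summable_subtype x _).tsum_add (EllOne.summable_subtype y _)
      map_smul' := fun c x => by
        ext t
        exact tsum_mul_left }
    1 fun x => by
      rw [one_mul]
      exact lp.norm_le_of_forall_le (norm_nonneg _) fun t => EllOne.norm_tsum_le x _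

variable {𝕜}

theorem continuous_tsum_le {T : LowerSet Omega} (x : EllOne 𝕜 T) :
    Continuous fun t : Completion T => ∑' s : {s : T | Completion.node s ≤ t}, x s := by
  have h : (fun t : Completion T => ∑' s : {s : T | Completion.node s ≤ t}, x s) =
      fun t => ∑' s : T, (Set.Ici (Completion.node s)).indicator (fun _ => x s) t := by
    funext t
    rw [tsum_subtype]
    rfl
  rw [h]
  refine continuous_tsum (fun s => ?_) (EllOne.summable_norm x) fun s t => ?_
  · exact continuous_const.indicator (by
      rw [(Completion.isClopen_Ici_node s).frontier_eq]; simp)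
  · exact norm_indicator_le_norm_self _ _

variable (𝕜)

/-- The operator `ℓ₁(T) → C(T ∪ ∂T)`, `x ↦ (t ↦ ∑_{s ∈ T, s ≤ t} x s)`. -/
noncomputable def smallSigma (T : LowerSet Omega) : EllOne 𝕜 T →L[𝕜] C(Completion T, 𝕜) :=
  LinearMap.mkContinuous
    { toFun := fun x =>
        ⟨fun t => ∑' s : {s : T | Completion.node s ≤ t}, x s, continuous_tsum_le x⟩
      map_add' := fun x y => by
        ext t
        exact (EllOne.summable_subtype x _).tsum_add (EllOne.summable_subtype y _)
      map_smul' := fun c x => by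
        ext t
        exact tsum_mul_left }
    1 fun x => by
      rw [one_mul]
      exact (ContinuousMap.norm_le _ (norm_nonneg _)).2 fun t => EllOne.norm_tsum_le x _

/-! ### Classes of operators -/

variable {𝕜}

/-- `S` factors through `T`: `S = V T U` for some bounded operators `U`, `V`. -/
def FactorsThrough {W Z X Y : Type*}
    [NormedAddCommGroup W] [NormedSpace 𝕜 W] [NormedAddCommGroup Z] [NormedSpace 𝕜 Z]
    [NormedAddCommGroup X] [NormedSpace 𝕜 X] [NormedAddCommGroup Y] [NormedSpace 𝕜 Y]
    (S : W →L[𝕜] Z) (T : X →L[𝕜] Y) : Prop :=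
  ∃ (U : W →L[𝕜] X) (V : Y →L[𝕜] Z), V ∘L T ∘L U = S

/-- The adjoint `T* : Y* → X*`, `f ↦ f ∘ T`, has norm-separable range. -/
def HasSeparableAdjointRange {X Y : Type*}
    [NormedAddCommGroup X] [NormedSpace 𝕜 X] [NormedAddCommGroup Y] [NormedSpace 𝕜 Y]
    (T : X →L[𝕜] Y) : Prop :=
  TopologicalSpace.IsSeparable
    (Set.range fun f : StrongDual 𝕜 Y => (f ∘L T : StrongDual 𝕜 X))

/-- `T` is Asplund: the restriction of `T` to every separable closed subspace has an adjoint
with separable range. -/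
def IsAsplund {X Y : Type*}
    [NormedAddCommGroup X] [NormedSpace 𝕜 X] [NormedAddCommGroup Y] [NormedSpace 𝕜 Y]
    (T : X →L[𝕜] Y) : Prop :=
  ∀ Z : Submodule 𝕜 X, IsClosed (Z : Set X) → TopologicalSpace.SeparableSpace Z →
    HasSeparableAdjointRange (T ∘L Z.subtypeL)

/-- `S` is non-Asplund and factors through every non-Asplund operator between Banach spaces. -/
def IsUniversalNonAsplund {W : Type u₁} {Z : Type v₁}
    [NormedAddCommGroup W] [NormedSpace 𝕜 W] [NormedAddCommGroup Z] [NormedSpace 𝕜 Z]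
    (S : W →L[𝕜] Z) : Prop :=
  ¬ IsAsplund S ∧
    ∀ (X : Type u) (Y : Type v)
      [NormedAddCommGroup X] [NormedSpace 𝕜 X] [CompleteSpace X]
      [NormedAddCommGroup Y] [NormedSpace 𝕜 Y] [CompleteSpace Y]
      (T : X →L[𝕜] Y), ¬ IsAsplund T → FactorsThrough S T

/-- `S` is universal for the non-Asplund operators with separable codomain. -/
def IsUniversalNonAsplundSepCodomain {W : Type u₁} {Z : Type v₁}
    [NormedAddCommGroup W] [NormedSpace 𝕜 W] [NormedAddCommGroup Z] [NormedSpace 𝕜 Z]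
    (S : W →L[𝕜] Z) : Prop :=
  (¬ IsAsplund S ∧ TopologicalSpace.SeparableSpace Z) ∧
    ∀ (X : Type u) (Y : Type v)
      [NormedAddCommGroup X] [NormedSpace 𝕜 X] [CompleteSpace X]
      [NormedAddCommGroup Y] [NormedSpace 𝕜 Y] [CompleteSpace Y]
      (T : X →L[𝕜] Y), ¬ IsAsplund T → TopologicalSpace.SeparableSpace Y → FactorsThrough S T

/-- `S` is universal for the operators that have separable codomain and whose adjoint has
non-separable range. -/
def IsUniversalNonSepAdjointSepCodomain {W : Type u₁} {Z : Type v₁}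
    [NormedAddCommGroup W] [NormedSpace 𝕜 W] [NormedAddCommGroup Z] [NormedSpace 𝕜 Z]
    (S : W →L[𝕜] Z) : Prop :=
  (¬ HasSeparableAdjointRange S ∧ TopologicalSpace.SeparableSpace Z) ∧
    ∀ (X : Type u) (Y : Type v)
      [NormedAddCommGroup X] [NormedSpace 𝕜 X] [CompleteSpace X]
      [NormedAddCommGroup Y] [NormedSpace 𝕜 Y] [CompleteSpace Y]
      (T : X →L[𝕜] Y), ¬ HasSeparableAdjointRange T → TopologicalSpace.SeparableSpace Y →
        FactorsThrough S T

variable (𝕜)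

/-- The universality assertions for the two operators of a tree `S`. -/
def UniversalityFor (S : LowerSet Omega) : Prop :=
  IsUniversalNonAsplund.{w, u, v} (bigSigma 𝕜 S) ∧
  IsUniversalNonSepAdjointSepCodomain.{w, u, v} (smallSigma 𝕜 S) ∧
  IsUniversalNonAsplundSepCodomain.{w, u, v} (smallSigma 𝕜 S)

end Operators

end TreeOperators

open TopologicalSpace TreeOperators

/-! The core is that `smallSigma` factors through every `T : X → Y` with separable `Y` and
non-separable adjoint range (`factorsThrough_smallSigma`). The dual ball of `Y` is then weak-*
compact and metrizable, and a Cantor–Bendixson argument (`exists_condensation`) leaves a subset each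
of whose non-empty relatively weak-* open pieces has an image under `T*` that is not within `δ` of
any separable set. Running through the nodes, parents first, one picks a functional `β s` in this
subset, weak-* close to that of the parent, and a bounded vector `x s` with `β s (T (x s)) = 1` that
the earlier `β t ∘ T` annihilate. Summing the errors along paths, `β t (T (x s))` is nearly `1` if
`s ≤ t` and nearly `0` otherwise.

Sending unit vectors to the `x s` gives `U`. The `β t` send `Y` into `C(Completion 𝒯, 𝕜)`, because
at the points of a dense sequence their increments along the tree are summable. The composite is so
close to `smallSigma` on unit vectors that a Neumann series corrects it
(`exists_comp_eq_smallSigma`).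

The rest is reduction. `bigSigma` is `smallSigma` followed by an isometric embedding into `ℓ_∞`;
injectivity of `ℓ_∞` allows `Y` to be replaced by the range of `T` when `X` is separable, and a
non-Asplund operator is restricted to a separable subspace. Conversely, uncountably many branches
give a 1-separated uncountable set in the adjoint range of `smallSigma`. -/

namespace TreeOperators

/-! ### Functionals at positive distance from a span -/

section Functionals

variable {𝕜 : Type*} [RCLike 𝕜] {X Y : Type*}
  [NormedAddCommGroup X] [NormedSpace 𝕜 X] [NormedAddCommGroup Y] [NormedSpace 𝕜 Y]

/-- A functional at distance more than `δ` from the span of finitely many functionals takes the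
value `1` at a vector of norm at most `δ⁻¹` annihilated by all of them. -/
theorem exists_apply_eq_one_of_lt_dist_span {ι : Type*} [Finite ι] (L : ι → StrongDual 𝕜 X)
    (f : StrongDual 𝕜 X) {δ : ℝ} (hδ : 0 < δ)
    (h : ∀ g ∈ Submodule.span 𝕜 (Set.range L), δ < ‖f - g‖) :
    ∃ x, ‖x‖ ≤ δ⁻¹ ∧ f x = 1 ∧ ∀ i, L i x = 0 := by
  have := Fintype.ofFinite ι
  let N : Submodule 𝕜 X := ⨅ i, LinearMap.ker (L i : X →ₗ[𝕜] 𝕜)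
  have hN : ∀ x, x ∈ N ↔ ∀ i, L i x = 0 := fun x => by simp [N]
  have hx : ∃ x ∈ N, δ * ‖x‖ < ‖f x‖ := by
    by_contra! hcon
    -- If `f` had norm at most `δ` on the common kernel `N`, a Hahn–Banach extension `k` of its
    -- restriction would put `f - k`, which vanishes on `N`, into the span at distance at most `δ`
    -- from `f`.
    obtain ⟨k, hk, hkn⟩ := exists_extension_norm_eq N (f ∘L N.subtypeL)
    have hle : ‖k‖ ≤ δ := by
      rw [hkn]
      exact ContinuousLinearMap.opNorm_le_bound _ hδ.le fun x => hcon x x.2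
    have hker : N ≤ LinearMap.ker ((f - k : StrongDual 𝕜 X) : X →ₗ[𝕜] 𝕜) := fun x hx => by
      have := hk ⟨x, hx⟩
      simp at this
      simp [this]
    obtain ⟨c, hc⟩ := (Submodule.mem_span_range_iff_exists_fun 𝕜).1
      (mem_span_of_iInf_ker_le_ker hker)
    have hmem : f - k ∈ Submodule.span 𝕜 (Set.range L) := by
      refine (Submodule.mem_span_range_iff_exists_fun 𝕜).2 ⟨c, ?_⟩
      ext x
      simpa using DFunLike.congr_fun hc x
    have := h _ hmem
    rw [sub_sub_cancel] at this
    exact absurd hle this.not_ge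
  obtain ⟨x, hxN, hx⟩ := hx
  have hpos : 0 < ‖f x‖ := (mul_nonneg hδ.le (norm_nonneg _)).trans_lt hx
  have hne : f x ≠ 0 := norm_pos_iff.1 hpos
  refine ⟨(f x)⁻¹ • x, ?_, by simp [hne], fun i => by simp [(hN x).1 hxN i]⟩
  rw [norm_smul, norm_inv, inv_mul_le_iff₀ hpos, ← div_eq_mul_inv, le_div_iff₀ hδ, mul_comm]
  exact hx.le

/-- If the adjoint of `T : X → Y` has non-separable range and `Y` is separable, then some part of
the dual unit ball of `Y` is mapped, locally in the weak-* topology, uniformly far away from every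
separable set. -/
theorem exists_condensation [SeparableSpace Y] (T : X →L[𝕜] Y)
    (hT : ¬ HasSeparableAdjointRange T) :
    ∃ δ > 0, ∃ A : Set (WeakDual 𝕜 Y), A.Nonempty ∧
      (∀ a ∈ A, ‖WeakDual.toStrongDual a‖ ≤ 1) ∧
      ∀ U, IsOpen U → (U ∩ A).Nonempty → ∀ F : Set (StrongDual 𝕜 X), IsSeparable F →
        ∃ a ∈ U ∩ A, ∀ g ∈ F, δ < ‖WeakDual.toStrongDual a ∘L T - g‖ := by
  let B : Set (WeakDual 𝕜 Y) := WeakDual.toStrongDual ⁻¹' Metric.closedBall 0 1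
  have hBc : IsCompact B := WeakDual.isCompact_closedBall 0 1
  have : CompactSpace B := isCompact_iff_compactSpace.1 hBc
  have : MetrizableSpace B := WeakDual.metrizable_of_isCompact 𝕜 Y B hBc
  have : SecondCountableTopology B := by
    let _ := metrizableSpaceMetric B
    infer_instance
  let R : B → StrongDual 𝕜 X := fun b => WeakDual.toStrongDual b.1 ∘L T
  -- `Small δ W`: the image of `W` lies within `δ` of a separable set. This is stable under
  -- countable unions, so the basic open small sets can be discarded together.
  let Small : ℝ → Set B → Prop := fun δ W =>
    ∃ S : Set (StrongDual 𝕜 X), IsSeparable S ∧ ∀ b ∈ W, ∃ g ∈ S, ‖R b - g‖ ≤ δ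
  have hδ : ∃ δ > 0, ¬ Small δ Set.univ := by
    by_contra! hcon
    choose S hS hRS using fun n : ℕ => hcon (1 / ((n : ℝ) + 1)) (by positivity)
    apply hT
    have h1 : IsSeparable (Set.range R) := by
      refine (IsSeparable.iUnion hS).closure.mono ?_
      rintro _ ⟨b, rfl⟩
      refine Metric.mem_closure_iff.2 fun ε hε => ?_
      obtain ⟨n, hn⟩ := exists_nat_one_div_lt hε
      obtain ⟨g, hg, hgn⟩ := hRS n b trivial
      exact ⟨g, Set.mem_iUnion.2 ⟨n, hg⟩, by rw [dist_eq_norm]; exact hgn.trans_lt hn⟩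
    refine (h1.span (R := 𝕜)).mono ?_
    rintro _ ⟨f, rfl⟩
    have hpos : 0 < ‖f‖ + 1 := by positivity
    have hmem : StrongDual.toWeakDual (((‖f‖ + 1 : ℝ) : 𝕜)⁻¹ • f) ∈ B := by
      simp only [B, Set.mem_preimage, mem_closedBall_zero_iff]
      change ‖((‖f‖ + 1 : ℝ) : 𝕜)⁻¹ • f‖ ≤ 1
      rw [norm_smul, norm_inv, RCLike.norm_ofReal, abs_of_pos hpos, inv_mul_le_iff₀ hpos]
      linarith
    have hf : (f ∘L T : StrongDual 𝕜 X) = ((‖f‖ + 1 : ℝ) : 𝕜) • R ⟨_, hmem⟩ := by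
      have hne : ((‖f‖ + 1 : ℝ) : 𝕜) ≠ 0 := by exact_mod_cast hpos.ne'
      ext x
      change f (T x) = ((‖f‖ + 1 : ℝ) : 𝕜) • (((‖f‖ + 1 : ℝ) : 𝕜)⁻¹ • f (T x))
      rw [smul_inv_smul₀ hne]
    change (f ∘L T : StrongDual 𝕜 X) ∈ _
    rw [hf]
    exact Submodule.smul_mem _ _ (Submodule.subset_span ⟨_, rfl⟩)
  obtain ⟨δ, hδ, hns⟩ := hδ
  let Bad : Set B := ⋃ V : {V : Set B // V ∈ countableBasis B ∧ Small δ V}, V.1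
  have hcount : Countable {V : Set B // V ∈ countableBasis B ∧ Small δ V} :=
    ((countable_countableBasis B).mono fun V hV => hV.1 :
      {V : Set B | V ∈ countableBasis B ∧ Small δ V}.Countable).to_subtype
  have hBad : Small δ Bad := by
    choose S hS hRS using fun V : {V : Set B // V ∈ countableBasis B ∧ Small δ V} => V.2.2
    refine ⟨⋃ V, S V, IsSeparable.iUnion hS, fun b hb => ?_⟩
    obtain ⟨V, hV⟩ := Set.mem_iUnion.1 hb
    obtain ⟨g, hg, hgb⟩ := hRS V b hV
    exact ⟨g, Set.mem_iUnion.2 ⟨V, hg⟩, hgb⟩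
  have hcompl : ∀ W : Set B, ¬ Small δ W → ∀ F : Set (StrongDual 𝕜 X), IsSeparable F →
      ∃ b ∈ W ∩ Badᶜ, ∀ g ∈ F, δ < ‖R b - g‖ := by
    intro W hW F hF
    by_contra! hcon
    obtain ⟨S, hS, hRS⟩ := hBad
    refine hW ⟨F ∪ S, hF.union hS, fun b hb => ?_⟩
    by_cases hbB : b ∈ Bad
    · obtain ⟨g, hg, hgb⟩ := hRS b hbB
      exact ⟨g, Or.inr hg, hgb⟩
    · obtain ⟨g, hg, hgb⟩ := hcon b ⟨hb, hbB⟩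
      exact ⟨g, Or.inl hg, hgb⟩
  refine ⟨δ, hδ, Subtype.val '' Badᶜ, ?_, ?_, ?_⟩
  · obtain ⟨b, hb, -⟩ := hcompl _ hns ∅ Set.finite_empty.isSeparable
    exact ⟨b, b, hb.2, rfl⟩
  · rintro _ ⟨b, -, rfl⟩
    exact mem_closedBall_zero_iff.1 b.2
  · rintro U hU ⟨_, hbU, b, hb, rfl⟩ F hF
    obtain ⟨V, hV, hbV, hVU⟩ := (isBasis_countableBasis B).exists_subset_of_mem_open
      (show b ∈ Subtype.val ⁻¹' U from hbU) (hU.preimage continuous_subtype_val)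
    -- A basic neighbourhood of a point outside `Bad` is not small, and removing the small set `Bad`
    -- from it cannot make it so.
    have hVs : ¬ Small δ V := fun hs => hb (Set.mem_iUnion.2 ⟨⟨V, hV, hs⟩, hbV⟩)
    obtain ⟨c, hc, hcF⟩ := hcompl V hVs F hF
    exact ⟨c, ⟨hVU hc.1, c, hc.2, rfl⟩, hcF⟩

end Functionals

/-- Recursive choice of a sequence whose `n`-th term is constrained by the previous ones. -/
theorem exists_seq_of_forall_exists {α : Type*} [Nonempty α] (R : ℕ → (ℕ → α) → α → Prop)
    (hR : ∀ n f g a, (∀ m < n, f m = g m) → R n f a → R n g a)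
    (h : ∀ n f, ∃ a, R n f a) : ∃ f : ℕ → α, ∀ n, R n f (f n) := by
  classical
  obtain ⟨d⟩ := ‹Nonempty α›
  choose F hF using h
  -- The filler `d` at indices from `n` on is harmless: by `hR`, the relation sees only earlier
  -- terms.
  let G : ∀ n, (∀ m < n, α) → α := fun n ih => F n fun m => if hm : m < n then ih m hm else d
  let f : ℕ → α := fun n => Nat.strongRec (motive := fun _ => α) G n
  have hf : ∀ n, f n = F n fun m => if m < n then f m else d := fun n => by
    change Nat.strongRec (motive := fun _ => α) G n = _
    rw [Nat.strongRec_eq]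
    rfl
  refine ⟨f, fun n => hR n _ f _ (fun m hm => ?_) ((hf n).symm ▸ hF n _)⟩
  exact if_pos hm

/-! ### An enumeration of the tree in which predecessors come first -/

namespace Omega

/-- The immediate predecessor of a non-empty sequence; the empty sequence is fixed. -/
def parent (s : Omega) : Omega := List.dropLast s

/-- The empty sequence. -/
def root : Omega := ([] : List ℕ)

/-- An enumeration of all finite sequences. -/
def code : Omega ≃ ℕ :=
  -- A list has a larger code than its tail; reversal turns `dropLast` into the tail, whence
  -- `code_parent_lt`.
  (⟨List.reverse, List.reverse, List.reverse_reverse, List.reverse_reverse⟩ :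
    List ℕ ≃ List ℕ).trans (Denumerable.eqv (List ℕ))

theorem parent_le (s : Omega) : parent s ≤ s := List.dropLast_prefix s

theorem root_le (s : Omega) : root ≤ s := List.nil_prefix

theorem le_iff_of_ne_root {s t : Omega} (ht : t ≠ root) : s ≤ t ↔ s = t ∨ s ≤ parent t := by
  have key : ∀ s t : List ℕ, t ≠ [] → (s <+: t ↔ s = t ∨ s <+: t.dropLast) := fun s t ht => by
    conv_lhs => rw [← List.dropLast_append_getLast ht]
    rw [List.prefix_concat_iff, List.dropLast_append_getLast ht]
  exact key s t ht

theorem code_root : code root = 0 := rfl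

theorem code_parent_lt {s : Omega} (hs : s ≠ root) : code (parent s) < code s := by
  have key : ∀ s : List ℕ, s ≠ [] →
      Encodable.encode s.dropLast.reverse < Encodable.encode s.reverse := fun s hs => by
    conv_rhs => rw [← List.dropLast_append_getLast hs]
    rw [List.reverse_append, List.reverse_singleton, List.singleton_append,
      Encodable.encode_list_cons]
    exact Nat.lt_succ_of_le (Nat.right_le_pair _ _)
  exact key s hs

/-- Induction along the tree. -/
theorem parent_induction {P : Omega → Prop} (h₀ : P root)
    (h : ∀ t, t ≠ root → P (parent t) → P t) (t : Omega) : P t := by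
  induction ht : code t using Nat.strong_induction_on generalizing t with
  | _ n ih =>
    by_cases hr : t = root
    · exact hr ▸ h₀
    · exact h t hr (ih _ (ht ▸ code_parent_lt hr) _ rfl)

theorem le_root_iff {s : Omega} : s ≤ root ↔ s = root :=
  ⟨fun h => le_antisymm h (root_le s), fun h => h.le⟩

theorem code_le_code {s t : Omega} (h : s ≤ t) : code s ≤ code t := by
  induction t using parent_induction with
  | h₀ => rw [le_root_iff.1 h]
  | h t ht ih =>
    rcases (le_iff_of_ne_root ht).1 h with rfl | h'
    · exact le_rfl
    · exact (ih h').trans (code_parent_lt ht).le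

theorem not_le_parent {t : Omega} (ht : t ≠ root) : ¬ t ≤ parent t := fun h =>
  (code_le_code h).not_gt (code_parent_lt ht)

instance : Countable Omega := code.injective.countable

end Omega

/-! ### Almost biorthogonal trees -/

section Trees

variable {𝕜 : Type*} [RCLike 𝕜] {X Y : Type*}
  [NormedAddCommGroup X] [NormedSpace 𝕜 X] [NormedAddCommGroup Y] [NormedSpace 𝕜 Y]

/-- Trees of functionals and of vectors such that each vector takes the value `1` at its own
functional and vanishes at all earlier ones, while each functional is close to its predecessor at
all earlier vectors and at an initial part of a given sequence. -/
theorem exists_triangular_tree [SeparableSpace Y] (T : X →L[𝕜] Y)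
    (hT : ¬ HasSeparableAdjointRange T) (y : ℕ → Y) {ε : ℝ} (hε : 0 < ε) :
    ∃ (C : ℝ) (β : Omega → StrongDual 𝕜 Y) (x : Omega → X),
      (∀ s, ‖β s‖ ≤ 1) ∧ (∀ s, ‖x s‖ ≤ C) ∧ (∀ s, β s (T (x s)) = 1) ∧
      (∀ s t, Omega.code t < Omega.code s → β t (T (x s)) = 0) ∧
      (∀ s, ∀ k < Omega.code s, ‖β s (y k) - β s.parent (y k)‖ ≤ (1 / 2) ^ Omega.code s) ∧
      ∀ s t, Omega.code t < Omega.code s →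
        ‖β s (T (x t)) - β s.parent (T (x t))‖ ≤ ε * (1 / 2) ^ Omega.code s := by
  obtain ⟨δ, hδ, A, hA, hA1, hAU⟩ := exists_condensation T hT
  have : Nonempty (A × X) := ⟨⟨⟨_, hA.some_mem⟩, 0⟩⟩
  -- The code of the parent of the `n`-th node. Here `p 0 = 0`, but at `n = 0` the conditions
  -- involving `p` are void.
  let p : ℕ → ℕ := fun n => Omega.code (Omega.code.symm n).parent
  have hp : ∀ n, n ≠ 0 → p n < n := fun n hn => by
    have := Omega.code_parent_lt (s := Omega.code.symm n) fun h => hn (by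
      rw [← Omega.code_root, ← h, Equiv.apply_symm_apply])
    rwa [Equiv.apply_symm_apply] at this
  obtain ⟨f, hf⟩ := exists_seq_of_forall_exists
    (R := fun n (f : ℕ → A × X) a => ‖a.2‖ ≤ δ⁻¹ ∧ a.1.1 (T a.2) = 1 ∧
      (∀ m < n, (f m).1.1 (T a.2) = 0) ∧
      (∀ k < n, ‖a.1.1 (y k) - (f (p n)).1.1 (y k)‖ ≤ (1 / 2) ^ n) ∧
      ∀ k < n, ‖a.1.1 (T (f k).2) - (f (p n)).1.1 (T (f k).2)‖ ≤ ε * (1 / 2) ^ n)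
    (by
      rintro n f g a hfg ⟨h1, h2, h3, h4, h5⟩
      refine ⟨h1, h2, fun m hm => hfg m hm ▸ h3 m hm, fun k hk => ?_, fun k hk => ?_⟩
      · rw [← hfg (p n) (hp n (by omega))]
        exact h4 k hk
      · rw [← hfg (p n) (hp n (by omega)), ← hfg k hk]
        exact h5 k hk)
    (by
      intro n f
      let c : WeakDual 𝕜 Y := (f (p n)).1.1
      have hopen : ∀ (z : Y) (r : ℝ), IsOpen {a : WeakDual 𝕜 Y | ‖a z - c z‖ < r} := fun z r =>
        isOpen_lt ((WeakDual.eval_continuous z).sub continuous_const).norm continuous_const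
      let U : Set (WeakDual 𝕜 Y) := (⋂ k : Fin n, {a | ‖a (y k) - c (y k)‖ < (1 / 2) ^ n}) ∩
        ⋂ k : Fin n, {a | ‖a (T (f k).2) - c (T (f k).2)‖ < ε * (1 / 2) ^ n}
      have hU : IsOpen U := (isOpen_iInter_of_finite fun k => hopen _ _).inter
        (isOpen_iInter_of_finite fun k => hopen _ _)
      have hcU : c ∈ U := ⟨Set.mem_iInter.2 fun k => by simp,
        Set.mem_iInter.2 fun k => by simpa using hε⟩
      let L : Fin n → StrongDual 𝕜 X := fun m => WeakDual.toStrongDual (f m).1.1 ∘L T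
      -- The parent's functional witnesses that `U` meets `A`; the separable set to avoid is the
      -- span of the functionals chosen so far, composed with `T`.
      obtain ⟨a, ⟨haU, haA⟩, ha⟩ := hAU U hU ⟨c, hcU, (f (p n)).1.2⟩
        (Submodule.span 𝕜 (Set.range L)) (Set.finite_range L).isSeparable.span
      obtain ⟨x, hx, hx1, hx0⟩ := exists_apply_eq_one_of_lt_dist_span L _ hδ ha
      exact ⟨⟨⟨a, haA⟩, x⟩, hx, hx1, fun m hm => hx0 ⟨m, hm⟩,
        fun k hk => (Set.mem_iInter.1 haU.1 ⟨k, hk⟩ : _ < _).le,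
        fun k hk => (Set.mem_iInter.1 haU.2 ⟨k, hk⟩ : _ < _).le⟩)
  refine ⟨δ⁻¹, fun s => WeakDual.toStrongDual (f (Omega.code s)).1.1,
    fun s => (f (Omega.code s)).2, fun s => hA1 _ (f _).1.2, fun s => (hf _).1,
    fun s => (hf _).2.1, fun s t hst => (hf _).2.2.1 _ hst, fun s k hk => ?_, fun s t hst => ?_⟩
  · simpa [p] using (hf _).2.2.2.1 k hk
  · simpa [p] using (hf _).2.2.2.2 _ hst

open Classical in
/-- In the situation of `exists_triangular_tree` the vectors are almost biorthogonal to the tree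
of functionals. -/
theorem norm_apply_sub_indicator_le {β : Omega → StrongDual 𝕜 Y} {z : Omega → Y} {ε : ℝ}
    (hε : 0 ≤ ε) (h₁ : ∀ s, β s (z s) = 1)
    (h₀ : ∀ s t, Omega.code t < Omega.code s → β t (z s) = 0)
    (h : ∀ s t, Omega.code t < Omega.code s →
      ‖β s (z t) - β s.parent (z t)‖ ≤ ε * (1 / 2) ^ Omega.code s) (s t : Omega) :
    ‖β t (z s) - if s ≤ t then 1 else 0‖ ≤ ε * (1 / 2) ^ Omega.code s := by
  have hlt : ∀ t, Omega.code t < Omega.code s → β t (z s) - (if s ≤ t then 1 else 0) = 0 :=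
    fun t ht => by
      rw [h₀ s t ht, if_neg fun hst => (Omega.code_le_code hst).not_gt ht, sub_zero]
  -- The subtracted term `(1 / 2) ^ Omega.code t` makes the induction close: it leaves room for the
  -- error of the step from `t.parent` to `t`.
  suffices H : Omega.code s ≤ Omega.code t → ‖β t (z s) - if s ≤ t then 1 else 0‖ ≤
      ε * ((1 / 2) ^ Omega.code s - (1 / 2) ^ Omega.code t) by
    rcases le_or_gt (Omega.code s) (Omega.code t) with hst | hst
    · refine (H hst).trans (mul_le_mul_of_nonneg_left ?_ hε)
      simp
    · rw [hlt t hst, norm_zero]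
      positivity
  induction t using Omega.parent_induction with
  | h₀ =>
    intro hs
    have : s = Omega.root := Omega.code.injective (by rw [Omega.code_root] at hs ⊢; omega)
    simp [this, h₁]
  | h t ht ih =>
    intro hs
    rcases hs.eq_or_lt with hs | hs
    · obtain rfl := Omega.code.injective hs
      simp [h₁]
    have hne : s ≠ t := fun hst => by simp [hst] at hs
    have hiff : s ≤ t ↔ s ≤ t.parent := by simp [Omega.le_iff_of_ne_root ht, hne]
    have hpt := Omega.code_parent_lt ht
    have hpow : ∀ m < Omega.code t,
        2 * (1 / 2 : ℝ) ^ Omega.code t ≤ (1 / 2 : ℝ) ^ m := fun m hm => by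
      have : (1 / 2 : ℝ) ^ Omega.code t ≤ (1 / 2) ^ (m + 1) :=
        pow_le_pow_of_le_one (by norm_num) (by norm_num) hm
      rw [pow_succ] at this
      linarith
    have hp : ‖β t.parent (z s) - if s ≤ t.parent then 1 else 0‖ ≤
        ε * ((1 / 2) ^ Omega.code s - 2 * (1 / 2) ^ Omega.code t) := by
      -- The parent may precede `s` in the enumeration even though `t` does not; there the error is
      -- exactly zero.
      rcases le_or_gt (Omega.code s) (Omega.code t.parent) with hst | hst
      · exact (ih hst).trans (mul_le_mul_of_nonneg_left (by linarith [hpow _ hpt]) hε)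
      · rw [hlt _ hst, norm_zero]
        exact mul_nonneg hε (by linarith [hpow _ hs])
    calc ‖β t (z s) - if s ≤ t then 1 else 0‖
        = ‖(β t (z s) - β t.parent (z s)) +
            (β t.parent (z s) - if s ≤ t.parent then 1 else 0)‖ := by
          simp only [hiff]; congr 1; ring
      _ ≤ ε * (1 / 2) ^ Omega.code t +
            ε * ((1 / 2) ^ Omega.code s - 2 * (1 / 2) ^ Omega.code t) :=
          norm_add_le_of_le (h t s hs) hp
      _ = _ := by ring

end Trees

/-! ### Operators from `ℓ₁` and into `ℓ_∞` -/

section Lp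

variable {𝕜 : Type*} [RCLike 𝕜] {X Y : Type*}
  [NormedAddCommGroup X] [NormedSpace 𝕜 X] [NormedAddCommGroup Y] [NormedSpace 𝕜 Y] {I : Type*}

theorem EllOne.norm_eq_tsum (x : EllOne 𝕜 I) : ‖x‖ = ∑' i, ‖x i‖ := by
  simpa using lp.norm_eq_tsum_rpow (p := 1) (by simp) x

theorem EllOne.summable_norm_smul {x : I → X} {C : ℝ} (hx : ∀ i, ‖x i‖ ≤ C) (a : EllOne 𝕜 I) :
    Summable fun i => ‖a i • x i‖ := by
  refine Summable.of_nonneg_of_le (fun _ => norm_nonneg _) (fun i => ?_)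
    ((EllOne.summable_norm a).mul_right C)
  rw [norm_smul]
  exact mul_le_mul_of_nonneg_left (hx i) (norm_nonneg _)

/-- The operator on `ℓ₁(I)` mapping the unit vectors to a given bounded family. -/
noncomputable def EllOne.lift [CompleteSpace X] (x : I → X) (C : ℝ) (hx : ∀ i, ‖x i‖ ≤ C) :
    EllOne 𝕜 I →L[𝕜] X :=
  LinearMap.mkContinuous
    { toFun := fun a => ∑' i, a i • x i
      map_add' := fun a b => by
        rw [← (EllOne.summable_norm_smul hx a).of_norm.tsum_add
          (EllOne.summable_norm_smul hx b).of_norm]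
        exact tsum_congr fun i => add_smul _ _ _
      map_smul' := fun c a => by
        rw [RingHom.id_apply, ← (EllOne.summable_norm_smul hx a).of_norm.tsum_const_smul c]
        exact tsum_congr fun i => smul_assoc c (a i) (x i) }
    C fun a => by
      rw [EllOne.norm_eq_tsum a, mul_comm, ← tsum_mul_right]
      refine tsum_of_norm_bounded ((EllOne.summable_norm a).mul_right C).hasSum fun i => ?_
      rw [norm_smul]
      exact mul_le_mul_of_nonneg_left (hx i) (norm_nonneg _)

theorem EllOne.lift_single [DecidableEq I] [CompleteSpace X] (x : I → X) (C : ℝ)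
    (hx : ∀ i, ‖x i‖ ≤ C) (i : I) :
    EllOne.lift x C hx (lp.single 1 i (1 : 𝕜)) = x i := by
  change ∑' j, (lp.single 1 i (1 : 𝕜) : EllOne 𝕜 I) j • x j = x i
  rw [tsum_eq_single i fun j hj => by rw [lp.single_apply_ne _ _ _ hj, zero_smul],
    lp.single_apply_self, one_smul]

/-- Operators on `ℓ₁(I)` agree if they agree on the unit vectors. -/
theorem EllOne.ext_single [DecidableEq I] {f g : EllOne 𝕜 I →L[𝕜] X}
    (h : ∀ i, f (lp.single 1 i 1) = g (lp.single 1 i 1)) : f = g :=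
  lp.ext_continuousLinearMap (by simp) fun i => ContinuousLinearMap.ext_ring (h i)

instance [Countable I] : SeparableSpace (EllOne 𝕜 I) := by
  classical
  rw [← isSeparable_univ_iff]
  have h : IsSeparable (Set.range fun i : I => (lp.single 1 i (1 : 𝕜) : EllOne 𝕜 I)) :=
    (Set.countable_range _).isSeparable
  refine (h.span (R := 𝕜)).closure.mono fun x _ => ?_
  refine mem_closure_of_tendsto (lp.hasSum_single (by simp) x) (Filter.Eventually.of_forall
    fun s => Submodule.sum_mem _ fun i _ => ?_)
  have : (lp.single 1 i (x i) : EllOne 𝕜 I) = x i • lp.single 1 i (1 : 𝕜) := by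
    rw [← lp.single_smul, smul_eq_mul, mul_one]
  rw [this]
  exact Submodule.smul_mem _ _ (Submodule.subset_span ⟨i, rfl⟩)

/-- The operator into `ℓ_∞(I)` given by a bounded family of functionals. -/
noncomputable def EllInfty.ofDual (f : I → StrongDual 𝕜 Y) (C : ℝ) (hf : ∀ i, ‖f i‖ ≤ C) :
    Y →L[𝕜] EllInfty 𝕜 I :=
  have hle : ∀ y i, ‖f i y‖ ≤ max C 0 * ‖y‖ := fun y i =>
    (f i).le_of_opNorm_le ((hf i).trans (le_max_left _ _)) y
  LinearMap.mkContinuous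
    { toFun := fun y => ⟨fun i => f i y, memℓp_infty
        ⟨max C 0 * ‖y‖, by rintro _ ⟨i, rfl⟩; exact hle y i⟩⟩
      map_add' := fun y z => by ext i; exact map_add (f i) y z
      map_smul' := fun c y => by ext i; exact map_smul (f i) c y }
    (max C 0) fun y => lp.norm_le_of_forall_le (by positivity) (hle y)

/-- `ℓ_∞(I)` is injective. -/
theorem EllInfty.exists_extension (p : Submodule 𝕜 Y) (V : p →L[𝕜] EllInfty 𝕜 I) :
    ∃ V' : Y →L[𝕜] EllInfty 𝕜 I, V' ∘L p.subtypeL = V := by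
  have hle : ∀ i y, ‖V y i‖ ≤ ‖V‖ * ‖y‖ := fun i y =>
    (lp.norm_apply_le_norm (by simp) (V y) i).trans (V.le_opNorm y)
  let g : I → StrongDual 𝕜 p := fun i => LinearMap.mkContinuous
    { toFun := fun y => V y i
      map_add' := fun y z => by rw [map_add]; rfl
      map_smul' := fun c y => by rw [map_smul]; rfl } ‖V‖ (hle i)
  -- Hahn–Banach, one coordinate at a time and without increase of norm.
  choose f hf hfn using fun i => exists_extension_norm_eq p (g i)
  refine ⟨EllInfty.ofDual f ‖V‖ fun i => ?_, ?_⟩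
  · rw [hfn]
    exact LinearMap.mkContinuous_norm_le _ (norm_nonneg _) _
  · ext y i
    exact hf i y

end Lp

/-! ### The completed tree -/

namespace Completion

variable {T : LowerSet Omega}

/-- A branch is the limit of its own nodes: along an ultrafilter finer than `atTop`, each wedge
contains them eventually exactly when its vertex is on the branch. -/
theorem denseRange_node : DenseRange (node : T → Completion T) := by
  intro a
  cases a with
  | node t => exact subset_closure ⟨t, rfl⟩
  | branch b =>
    have : Nonempty b.1 := b.2.2.nonempty.to_subtype
    have : IsDirectedOrder b.1 := ⟨fun s t => (b.2.1.1.total s.2 t.2).elim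
      (fun h => ⟨t, h, le_rfl⟩) fun h => ⟨s, le_rfl, h⟩⟩
    let f : Ultrafilter b.1 := Ultrafilter.of Filter.atTop
    refine mem_closure_iff_ultrafilter.2 ⟨f.map fun s : b.1 => node s.1, ?_, ?_⟩
    · exact Ultrafilter.mem_map.2 (Filter.univ_mem' fun s => ⟨s.1, rfl⟩)
    · refine le_nhds_of_forall _ _ fun s => ⟨fun hs => ?_, fun hs => ?_⟩
      · exact Ultrafilter.of_le _ (Filter.mem_atTop (⟨s, hs⟩ : b.1))
      · obtain ⟨t, ht⟩ := Filter.nonempty_of_mem (f := (f : Filter b.1)) hs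
        exact boundary.mem_of_le b.2 ht t.2

/-- Only nodes are non-limit, so the defining subbase is countable. With compactness and the
Hausdorff property this makes `C(Completion T, 𝕜)` separable. -/
instance : SecondCountableTopology (Completion T) := by
  refine ⟨⟨_, ?_, rfl⟩⟩
  have : (⋃ t : T, {Set.Ici (node t), (Set.Ici (node t))ᶜ}).Countable :=
    Set.countable_iUnion fun t => (Set.toFinite _).countable
  refine this.mono ?_
  rintro U ⟨a, ha, hU⟩
  obtain ⟨t, rfl⟩ := (isNonLimit_iff a).1 ha
  exact Set.mem_iUnion.2 ⟨t, hU⟩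

/-- A node has finitely many nodes below it and a branch infinitely many, so the two cannot be
confused. -/
theorem eq_of_forall_node_le_iff {a b : Completion T} (h : ∀ s : T, node s ≤ a ↔ node s ≤ b) :
    a = b := by
  have aux : ∀ (t : T) (c : boundary T), ¬ ∀ s : T, node s ≤ node t ↔ node s ≤ branch c :=
    fun t c h => c.2.2 (((Omega.finite_Iic (t : Omega)).preimage
      Subtype.val_injective.injOn).subset fun s hs => (h s).2 hs)
  cases a with
  | node s =>
    cases b with
    | node t => exact le_antisymm ((h s).1 le_rfl) ((h t).2 le_rfl)
    | branch c => exact absurd h (aux s c)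
  | branch b =>
    cases ‹Completion T› with
    | node t => exact absurd (fun s => (h s).symm) (aux t b)
    | branch c => exact congrArg branch (Subtype.ext (Set.ext h))

instance : T2Space (Completion T) := by
  refine ⟨fun a b hab => ?_⟩
  have : ∃ s : T, ¬ (node s ≤ a ↔ node s ≤ b) := by
    by_contra! h
    exact hab (eq_of_forall_node_le_iff h)
  obtain ⟨s, hs⟩ := this
  have hc := isClopen_Ici_node s
  by_cases ha : node s ≤ a
  · exact ⟨_, _, hc.isOpen, hc.compl.isOpen, ha, fun hb => hs (iff_of_true ha hb),
      disjoint_compl_right⟩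
  · exact ⟨_, _, hc.compl.isOpen, hc.isOpen, ha, by_contra fun hb => hs (iff_of_false ha hb),
      disjoint_compl_left⟩

end Completion

/-! ### Restriction to the nodes, and increments along the tree -/

section Sigma

variable {𝕜 : Type*} [RCLike 𝕜] {T : LowerSet Omega}

/-- The isometric embedding of `C(T ∪ ∂T)` into `ℓ_∞(T)` by restriction. -/
noncomputable def nodeRestriction (𝕜 : Type*) [RCLike 𝕜] (T : LowerSet Omega) :
    C(Completion T, 𝕜) →ₗᵢ[𝕜] EllInfty 𝕜 T where
  toFun f := ⟨fun t => f (.node t), memℓp_infty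
    ⟨‖f‖, by rintro _ ⟨t, rfl⟩; exact f.norm_coe_le_norm _⟩⟩
  map_add' _ _ := rfl
  map_smul' _ _ := rfl
  norm_map' f := by
    refine le_antisymm (lp.norm_le_of_forall_le (norm_nonneg _) fun t => f.norm_coe_le_norm _)
      ((ContinuousMap.norm_le _ (norm_nonneg _)).2 fun a => ?_)
    refine Completion.denseRange_node.induction_on (p := fun a => ‖f a‖ ≤ _) a
      (isClosed_le f.continuous.norm continuous_const) fun t => ?_
    exact lp.norm_apply_le_norm (E := fun _ : T => 𝕜) (p := ∞) (by simp)
      ⟨fun t => f (.node t), _⟩ t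

open Classical in
theorem smallSigma_single (s : T) (a : Completion T) :
    smallSigma 𝕜 T (lp.single 1 s 1) a = if .node s ≤ a then 1 else 0 := by
  change ∑' r : {r : T | .node r ≤ a}, (lp.single 1 s (1 : 𝕜) : EllOne 𝕜 T) r = _
  rw [tsum_subtype _ fun r => (lp.single 1 s (1 : 𝕜) : EllOne 𝕜 T) r, tsum_eq_single s]
  · simp [Set.indicator_apply]
  · intro r hr
    rw [Set.indicator_apply, lp.single_apply_ne _ _ _ hr, ite_self]

/-- The immediate predecessor in a downwards closed tree. -/
def treeParent (t : T) : T := ⟨t.1.parent, T.lower t.1.parent_le t.2⟩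

open Classical in
/-- The increment of a function on the tree at a node. -/
noncomputable def increment (g : T → 𝕜) (t : T) : 𝕜 :=
  g t - if t.1 = Omega.root then 0 else g (treeParent t)

theorem finite_Iic (t : T) : (Set.Iic t).Finite :=
  ((Omega.finite_Iic t.1).preimage Subtype.val_injective.injOn).subset fun s hs =>
    (hs : s.1 ≤ t.1)

/-- Telescoping from the root. Thus a function on the nodes with summable increments is the
restriction of a value of `smallSigma`. -/
theorem tsum_Iic_increment (g : T → 𝕜) (t : T) : ∑' s : Set.Iic t, increment g s = g t := by
  classical
  have hsum : ∀ t : T, ∑' s : Set.Iic t, increment g s =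
      ∑ s ∈ (finite_Iic t).toFinset, increment g s := fun t => by
    rw [← Finset.tsum_subtype', (finite_Iic t).coe_toFinset]
  rw [hsum]
  obtain ⟨t, ht⟩ := t
  induction t using Omega.parent_induction with
  | h₀ =>
    have : (finite_Iic (⟨Omega.root, ht⟩ : T)).toFinset = {⟨Omega.root, ht⟩} := by
      ext s
      simpa [Subtype.ext_iff, ← Subtype.coe_le_coe] using Omega.le_root_iff (s := s.1)
    rw [this, Finset.sum_singleton, increment, if_pos rfl, sub_zero]
  | h t hr ih =>
    have hp : t.parent ∈ T := T.lower t.parent_le ht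
    have : (finite_Iic (⟨t, ht⟩ : T)).toFinset =
        insert ⟨t, ht⟩ (finite_Iic (⟨t.parent, hp⟩ : T)).toFinset := by
      ext s
      simpa [Subtype.ext_iff, ← Subtype.coe_le_coe] using Omega.le_iff_of_ne_root (s := s.1) hr
    rw [this, Finset.sum_insert (by simpa using Omega.not_le_parent hr), ih hp, increment,
      if_neg hr]
    exact sub_add_cancel _ _

open Classical in
/-- The increment at a node, as a functional on `C(T ∪ ∂T)`. -/
noncomputable def incrementCLM (𝕜 : Type*) [RCLike 𝕜] (t : T) : StrongDual 𝕜 C(Completion T, 𝕜) :=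
  ContinuousMap.evalCLM 𝕜 (.node t) -
    if t.1 = Omega.root then 0 else ContinuousMap.evalCLM 𝕜 (.node (treeParent t))

theorem norm_incrementCLM_le (t : T) : ‖incrementCLM 𝕜 t‖ ≤ 2 := by
  have h : ∀ a : Completion T,
      ‖(ContinuousMap.evalCLM 𝕜 a : StrongDual 𝕜 C(Completion T, 𝕜))‖ ≤ 1 := fun a =>
    ContinuousLinearMap.opNorm_le_bound _ zero_le_one fun f => by
      rw [one_mul]; exact f.norm_coe_le_norm a
  refine (norm_sub_le _ _).trans ?_
  rw [← one_add_one_eq_two]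
  refine add_le_add (h _) ?_
  split_ifs
  · simp
  · exact h _

-- Biorthogonality to the images of the unit vectors is what lets `exists_comp_eq_smallSigma` adjust
-- each image independently.
open Classical in
theorem incrementCLM_smallSigma_single (s t : T) :
    incrementCLM 𝕜 t (smallSigma 𝕜 T (lp.single 1 s 1)) = if s = t then 1 else 0 := by
  rw [incrementCLM, sub_apply, ContinuousMap.evalCLM_apply, smallSigma_single]
  by_cases hr : t.1 = Omega.root
  · have : s ≤ t ↔ s = t := by
      rw [← Subtype.coe_le_coe, hr, Omega.le_root_iff, ← hr, Subtype.ext_iff]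
    simp [hr, this]
  · have h1 : s ≤ t ↔ s = t ∨ s ≤ treeParent t := by
      rw [Subtype.ext_iff]; exact Omega.le_iff_of_ne_root hr
    have h2 : ¬ t ≤ treeParent t := Omega.not_le_parent hr
    rw [if_neg hr, ContinuousMap.evalCLM_apply, smallSigma_single]
    simp only [Completion.node_le_node]
    by_cases hst : s = t
    · subst hst
      simp [h2]
    · simp [h1, hst]

end Sigma

section Factorization

variable {𝕜 : Type*} [RCLike 𝕜] {X Y : Type*}
  [NormedAddCommGroup X] [NormedSpace 𝕜 X] [NormedAddCommGroup Y] [NormedSpace 𝕜 Y]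

theorem Omega.summable_geometric_code (T : LowerSet Omega) :
    Summable fun t : T => (1 / 2 : ℝ) ^ Omega.code t.1 :=
  summable_geometric_two.comp_injective (Omega.code.injective.comp Subtype.val_injective)

theorem Omega.tsum_geometric_code_le (T : LowerSet Omega) :
    ∑' t : T, (1 / 2 : ℝ) ^ Omega.code t.1 ≤ 2 := by
  refine le_of_le_of_eq ?_ tsum_geometric_two
  exact (Omega.summable_geometric_code T).tsum_le_tsum_of_inj (fun t : T => Omega.code t.1)
    (Omega.code.injective.comp Subtype.val_injective) (fun _ _ => by positivity)
    (fun _ => le_rfl) summable_geometric_two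

/-! ### Perturbation of the summation operator -/

open Classical in
/-- An operator close to `smallSigma 𝕜 T` at the unit vectors has the latter as a left multiple. -/
theorem exists_comp_eq_smallSigma {T : LowerSet Omega} (W : EllOne 𝕜 T →L[𝕜] C(Completion T, 𝕜))
    (hW : ∀ s, ‖nodeRestriction 𝕜 T (W (lp.single 1 s 1) - smallSigma 𝕜 T (lp.single 1 s 1))‖ ≤
      1 / 8 * (1 / 2) ^ Omega.code s.1) :
    ∃ Q : C(Completion T, 𝕜) →L[𝕜] C(Completion T, 𝕜), Q ∘L W = smallSigma 𝕜 T := by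
  let R : T → C(Completion T, 𝕜) := fun s =>
    W (lp.single 1 s 1) - smallSigma 𝕜 T (lp.single 1 s 1)
  let p : T → C(Completion T, 𝕜) →L[𝕜] C(Completion T, 𝕜) := fun s =>
    (incrementCLM 𝕜 s).smulRight (R s)
  have hp : ∀ s, ‖p s‖ ≤ 1 / 4 * (1 / 2) ^ Omega.code s.1 := fun s => by
    have hR : ‖R s‖ ≤ 1 / 8 * (1 / 2) ^ Omega.code s.1 := by
      simpa only [LinearIsometry.norm_map] using hW s
    calc ‖p s‖ = ‖incrementCLM 𝕜 s‖ * ‖R s‖ := ContinuousLinearMap.norm_smulRight_apply _ _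
      _ ≤ 2 * (1 / 8 * (1 / 2) ^ Omega.code s.1) :=
        mul_le_mul (norm_incrementCLM_le s) hR (norm_nonneg _) zero_le_two
      _ = _ := by ring
  have hsum := (Omega.summable_geometric_code T).mul_left (1 / 4)
  have hps : Summable p := Summable.of_norm_bounded hsum hp
  -- The factor `2` from the increment functionals, the `1 / 8` of the hypothesis and a geometric
  -- sum of at most `2` give `1 / 2`. The sum of the `p s` carries the image of each unit vector
  -- under `smallSigma` to the error `R s`.
  have hP : ‖-∑' s, p s‖ < 1 := by
    rw [norm_neg]
    refine (tsum_of_norm_bounded hsum.hasSum hp).trans_lt ?_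
    rw [tsum_mul_left]
    linarith [Omega.tsum_geometric_code_le T]
  obtain ⟨Q, hQ⟩ := (isUnit_one_sub_of_norm_lt_one
    (R := C(Completion T, 𝕜) →L[𝕜] C(Completion T, 𝕜)) hP).exists_left_inv
  refine ⟨Q, ?_⟩
  have hmul : (1 - -∑' s, p s) ∘L smallSigma 𝕜 T = W := EllOne.ext_single fun s => by
    have h : (∑' r, p r) (smallSigma 𝕜 T (lp.single 1 s 1)) = R s := by
      have h1 := (hps.hasSum.mapL
        (ContinuousLinearMap.apply 𝕜 _ (smallSigma 𝕜 T (lp.single 1 s 1)))).tsum_eq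
      refine h1.symm.trans ?_
      rw [tsum_eq_single s]
      · change incrementCLM 𝕜 s (smallSigma 𝕜 T (lp.single 1 s 1)) • R s = R s
        rw [incrementCLM_smallSigma_single, if_pos rfl, one_smul]
      · intro r hr
        change incrementCLM 𝕜 r (smallSigma 𝕜 T (lp.single 1 s 1)) • R r = 0
        rw [incrementCLM_smallSigma_single, if_neg hr.symm, zero_smul]
    rw [sub_neg_eq_add]
    change smallSigma 𝕜 T (lp.single 1 s 1) + (∑' r, p r) (smallSigma 𝕜 T (lp.single 1 s 1)) = _
    rw [h]
    exact add_sub_cancel _ _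
  calc Q ∘L W = (Q * (1 - -∑' s, p s)) ∘L smallSigma 𝕜 T := by rw [← hmul]; rfl
    _ = smallSigma 𝕜 T := by rw [hQ]; rfl

/-! ### Factorizations -/

/-- A family of functionals on a tree, with summable increments at the points of a dense sequence,
induces an operator into the continuous functions on the completed tree. -/
theorem exists_lift_nodeRestriction {T : LowerSet Omega} {y : ℕ → Y} (hy : DenseRange y)
    {β : Omega → StrongDual 𝕜 Y} (hβ : ∀ s, ‖β s‖ ≤ 1)
    (h : ∀ s, ∀ k < Omega.code s, ‖β s (y k) - β s.parent (y k)‖ ≤ (1 / 2) ^ Omega.code s) :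
    ∃ V : Y →L[𝕜] C(Completion T, 𝕜), ∀ (z : Y) (t : T), V z (.node t) = β t z := by
  let V₀ : Y →L[𝕜] EllInfty 𝕜 T := EllInfty.ofDual (fun t => β t) 1 fun t => hβ t
  let J := nodeRestriction 𝕜 T
  have hclosed : IsClosed (Set.range J) := J.isometry.isClosedEmbedding.isClosed_range
  -- The range of the isometry `J` is closed, so the dense sequence suffices; at `y k` the
  -- increments are geometrically bounded at all but the finitely many nodes of code at most `k`.
  have hmem : ∀ z, V₀ z ∈ LinearMap.range J.toLinearMap := fun z => by
    refine hy.induction_on (p := fun z => V₀ z ∈ Set.range J) z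
      (hclosed.preimage V₀.continuous) fun k => ?_
    let g : T → 𝕜 := fun t => β t (y k)
    have hsum : Summable fun t => ‖increment g t‖ := by
      refine Summable.of_norm_bounded_eventually (Omega.summable_geometric_code T) ?_
      have hfin : {t : T | Omega.code t.1 ≤ k}.Finite :=
        (Set.finite_Iic k).preimage (Omega.code.injective.comp Subtype.val_injective).injOn
      refine hfin.subset fun t ht => ?_
      by_contra hlt
      have hlt : k < Omega.code t.1 := not_le.1 hlt
      have hr : t.1 ≠ Omega.root := fun hr => by rw [hr, Omega.code_root] at hlt; omega
      refine ht ?_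
      change ‖‖increment g t‖‖ ≤ _
      rw [norm_norm, increment, if_neg hr]
      exact h t.1 k hlt
    refine ⟨smallSigma 𝕜 T ⟨increment g, memℓp_gen (by simpa using hsum)⟩, ?_⟩
    ext t
    exact tsum_Iic_increment g t
  let V : Y →L[𝕜] C(Completion T, 𝕜) :=
    (J.equivRange.symm : _ →L[𝕜] C(Completion T, 𝕜)) ∘L V₀.codRestrict _ hmem
  refine ⟨V, fun z t => ?_⟩
  have hJ : J (V z) = V₀ z :=
    congrArg Subtype.val (J.equivRange.apply_symm_apply ⟨V₀ z, hmem z⟩)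
  exact congrArg (fun f : EllInfty 𝕜 T => f t) hJ

theorem factorsThrough_smallSigma [CompleteSpace X] [SeparableSpace Y] (T : X →L[𝕜] Y)
    (hT : ¬ HasSeparableAdjointRange T) (𝒯 : LowerSet Omega) :
    FactorsThrough (smallSigma 𝕜 𝒯) T := by
  classical
  obtain ⟨C, β, x, hβ, hx, h₁, h₀, hy, hz⟩ :=
    exists_triangular_tree T hT (denseSeq Y) (ε := 1 / 8) (by norm_num)
  obtain ⟨V, hV⟩ := exists_lift_nodeRestriction (T := 𝒯) (denseRange_denseSeq Y) hβ hy
  let U : EllOne 𝕜 𝒯 →L[𝕜] X := EllOne.lift (fun s => x s) C fun s => hx s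
  obtain ⟨Q, hQ⟩ := exists_comp_eq_smallSigma (V ∘L T ∘L U) fun s => by
    refine lp.norm_le_of_forall_le (by positivity) fun t => ?_
    have := norm_apply_sub_indicator_le (z := fun s => T (x s)) (by norm_num) h₁ h₀ hz s.1 t.1
    refine le_of_eq_of_le (congrArg norm ?_) this
    change V (T (U (lp.single 1 s 1))) (.node t) - smallSigma 𝕜 𝒯 (lp.single 1 s 1) (.node t) = _
    rw [hV, smallSigma_single, EllOne.lift_single]
    rfl
  exact ⟨U, Q ∘L V, hQ⟩

end Factorization

/-! ### Stability under factorization and reduction to separable spaces -/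

section Classes

variable {𝕜 : Type*} [RCLike 𝕜] {W Z X Y X' Y' : Type*}
  [NormedAddCommGroup W] [NormedSpace 𝕜 W] [NormedAddCommGroup Z] [NormedSpace 𝕜 Z]
  [NormedAddCommGroup X] [NormedSpace 𝕜 X] [NormedAddCommGroup Y] [NormedSpace 𝕜 Y]
  [NormedAddCommGroup X'] [NormedSpace 𝕜 X'] [NormedAddCommGroup Y'] [NormedSpace 𝕜 Y']

theorem FactorsThrough.trans {R : W →L[𝕜] Z} {S : X' →L[𝕜] Y'} {T : X →L[𝕜] Y}
    (h₁ : FactorsThrough R S) (h₂ : FactorsThrough S T) : FactorsThrough R T := by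
  obtain ⟨U, V, rfl⟩ := h₁
  obtain ⟨U', V', rfl⟩ := h₂
  exact ⟨U' ∘L U, V ∘L V', rfl⟩

theorem FactorsThrough.comp_left (V : Y →L[𝕜] Z) (T : X →L[𝕜] Y) : FactorsThrough (V ∘L T) T :=
  ⟨ContinuousLinearMap.id 𝕜 X, V, rfl⟩

theorem FactorsThrough.comp_right (T : X →L[𝕜] Y) (U : W →L[𝕜] X) : FactorsThrough (T ∘L U) T :=
  ⟨U, ContinuousLinearMap.id 𝕜 Y, rfl⟩

theorem bigSigma_factorsThrough_smallSigma (𝒯 : LowerSet Omega) :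
    FactorsThrough (bigSigma 𝕜 𝒯) (smallSigma 𝕜 𝒯) :=
  .comp_left (nodeRestriction 𝕜 𝒯).toContinuousLinearMap _

/-- Having an adjoint with separable range passes to operators factoring through. -/
theorem HasSeparableAdjointRange.of_factorsThrough {S : W →L[𝕜] Z} {T : X →L[𝕜] Y}
    (hT : HasSeparableAdjointRange T) (h : FactorsThrough S T) : HasSeparableAdjointRange S := by
  obtain ⟨U, V, rfl⟩ := h
  have hc : Continuous fun f : StrongDual 𝕜 X => (f ∘L U : StrongDual 𝕜 W) :=
    continuous_id.clm_comp continuous_const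
  refine (IsSeparable.image hT hc).mono ?_
  rintro _ ⟨f, rfl⟩
  exact ⟨_, ⟨f ∘L V, rfl⟩, rfl⟩

/-- An operator and its composition with an isometric embedding of the codomain have the same
adjoint range. -/
theorem HasSeparableAdjointRange.of_isometry_comp {T : X →L[𝕜] Y} (J : Y →ₗᵢ[𝕜] Z)
    (h : HasSeparableAdjointRange (J.toContinuousLinearMap ∘L T)) :
    HasSeparableAdjointRange T := by
  refine IsSeparable.mono h ?_
  rintro _ ⟨f, rfl⟩
  -- Each functional on `Y` is carried to the range of `J` and extended to `Z`, so composing with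
  -- `J` loses no element of the adjoint range.
  obtain ⟨g, hg, -⟩ := exists_extension_norm_eq (LinearMap.range J.toLinearMap)
    (f ∘L (J.equivRange.symm : _ →L[𝕜] Y))
  refine ⟨g, ?_⟩
  ext x
  have := hg (J.equivRange (T x))
  refine this.trans ?_
  change f (J.equivRange.symm (J.equivRange (T x))) = f (T x)
  rw [LinearIsometryEquiv.symm_apply_apply]

/-- If `S` has separable domain and adjoint of non-separable range, every operator through which
it factors fails to be Asplund. -/
theorem FactorsThrough.not_isAsplund [SeparableSpace W] {S : W →L[𝕜] Z} {T : X →L[𝕜] Y}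
    (h : FactorsThrough S T) (hS : ¬ HasSeparableAdjointRange S) : ¬ IsAsplund T := by
  intro hT
  obtain ⟨U, V, rfl⟩ := h
  -- The closed range of `U` is a separable subspace on which the restriction of `T` still factors
  -- `S`.
  let R : Submodule 𝕜 X := (LinearMap.range (U : W →ₗ[𝕜] X)).topologicalClosure
  have hR : IsSeparable (R : Set X) := (isSeparable_range U.continuous).closure
  have hsep := hT R (Submodule.isClosed_topologicalClosure _) hR.separableSpace
  exact hS (hsep.of_factorsThrough
    ⟨U.codRestrict R fun w => Submodule.le_topologicalClosure _ ⟨w, rfl⟩, V, rfl⟩)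

/-- The range of `T` is separable, so the separable-codomain case applies to `T` corestricted to it;
the left factor then extends to `Y` because `ℓ_∞` is injective. -/
theorem factorsThrough_bigSigma_of_separable_domain [CompleteSpace X] [SeparableSpace X]
    (T : X →L[𝕜] Y) (hT : ¬ HasSeparableAdjointRange T) (𝒯 : LowerSet Omega) :
    FactorsThrough (bigSigma 𝕜 𝒯) T := by
  let R : Submodule 𝕜 Y := LinearMap.range (T : X →ₗ[𝕜] Y)
  have hR : IsSeparable (R : Set Y) := isSeparable_range T.continuous
  have := hR.separableSpace
  let T₀ : X →L[𝕜] R := T.codRestrict R fun x => ⟨x, rfl⟩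
  have hT₀ : ¬ HasSeparableAdjointRange T₀ := fun h =>
    hT (h.of_factorsThrough (.comp_left R.subtypeL T₀))
  obtain ⟨U, V, hUV⟩ :=
    (bigSigma_factorsThrough_smallSigma 𝒯).trans (factorsThrough_smallSigma T₀ hT₀ 𝒯)
  obtain ⟨V', hV'⟩ := EllInfty.exists_extension R V
  refine ⟨U, V', ?_⟩
  rw [← hUV, ← hV']
  rfl

theorem not_hasSeparableAdjointRange_of_not_isAsplund {T : X →L[𝕜] Y} (hT : ¬ IsAsplund T) :
    ¬ HasSeparableAdjointRange T := fun h =>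
  hT fun Z _ _ => h.of_factorsThrough (.comp_right T Z.subtypeL)

theorem factorsThrough_bigSigma_of_not_isAsplund [CompleteSpace X] {T : X →L[𝕜] Y}
    (hT : ¬ IsAsplund T) (𝒯 : LowerSet Omega) : FactorsThrough (bigSigma 𝕜 𝒯) T := by
  simp only [IsAsplund, not_forall] at hT
  obtain ⟨Z, hZ, hs, hn⟩ := hT
  have : CompleteSpace Z := hZ.completeSpace_coe
  exact (factorsThrough_bigSigma_of_separable_domain _ hn 𝒯).trans (.comp_right T Z.subtypeL)

end Classes

/-! ### Trees with uncountably many branches -/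

section Branches

variable (𝕜 : Type*) [RCLike 𝕜] {𝒮 : LowerSet Omega}

/-- Evaluations at two distinct branches, composed with `smallSigma`, differ by modulus `1` at the
unit vector of a node lying on only one of them. -/
theorem not_hasSeparableAdjointRange_smallSigma (h𝒮 : ¬ (boundary 𝒮).Countable) :
    ¬ HasSeparableAdjointRange (smallSigma 𝕜 𝒮) := by
  classical
  intro hsep
  let D : Set (StrongDual 𝕜 (EllOne 𝕜 𝒮)) :=
    Set.range fun f : StrongDual 𝕜 C(Completion 𝒮, 𝕜) => f ∘L smallSigma 𝕜 𝒮
  have : SeparableSpace D := IsSeparable.separableSpace hsep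
  let e : boundary 𝒮 → D := fun b =>
    ⟨ContinuousMap.evalCLM 𝕜 (.branch b) ∘L smallSigma 𝕜 𝒮, _, rfl⟩
  have he : ∀ b c : boundary 𝒮, ∀ s ∈ b.1, s ∉ c.1 → 1 ≤ dist (e b) (e c) := by
    intro b c s hb hc
    have h : (e b).1 (lp.single 1 s 1) - (e c).1 (lp.single 1 s 1) = 1 := by
      change smallSigma 𝕜 𝒮 _ (.branch b) - smallSigma 𝕜 𝒮 _ (.branch c) = 1
      rw [smallSigma_single, smallSigma_single]
      simp [hb, hc]
    rw [Subtype.dist_eq, dist_eq_norm]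
    have := ((e b).1 - (e c).1).le_opNorm (lp.single 1 s 1)
    rw [sub_apply, h, lp.norm_single (by simp)] at this
    simpa using this
  have hdist : Pairwise fun b c : boundary 𝒮 => 1 ≤ dist (e b) (e c) := by
    intro b c hbc
    have : b.1 ≠ c.1 := fun h => hbc (Subtype.ext h)
    by_cases hsub : b.1 ⊆ c.1
    · obtain ⟨s, hs, hs'⟩ := Set.not_subset.1 fun h => this (hsub.antisymm h)
      rw [dist_comm]
      exact he c b s hs hs'
    · obtain ⟨s, hs, hs'⟩ := Set.not_subset.1 hsub
      exact he b c s hs hs'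
  have hcount : Countable (boundary 𝒮) := by
    -- Balls of radius `1 / 2` about 1-separated points are disjoint, and a separable space admits
    -- only countably many.
    refine Pairwise.countable_of_isOpen_disjoint (s := fun b => Metric.ball (e b) (1 / 2))
      (fun b c hbc => Metric.ball_disjoint_ball ?_) (fun b => Metric.isOpen_ball)
      fun b => ⟨e b, Metric.mem_ball_self (by norm_num)⟩
    norm_num
    exact hdist hbc
  exact h𝒮 (Set.countable_coe_iff.1 hcount)

theorem not_hasSeparableAdjointRange_bigSigma (h𝒮 : ¬ (boundary 𝒮).Countable) :
    ¬ HasSeparableAdjointRange (bigSigma 𝕜 𝒮) := fun h =>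
  not_hasSeparableAdjointRange_smallSigma 𝕜 h𝒮
    (HasSeparableAdjointRange.of_isometry_comp (nodeRestriction 𝕜 𝒮) h)

theorem universalityFor (𝕜 : Type w) [RCLike 𝕜] {𝒮 : LowerSet Omega}
    (h𝒮 : ¬ (boundary 𝒮).Countable) : UniversalityFor.{w, u, v} 𝕜 𝒮 := by
  have h := not_hasSeparableAdjointRange_smallSigma 𝕜 h𝒮
  refine ⟨⟨?_, ?_⟩, ⟨⟨h, inferInstance⟩, ?_⟩, ⟨⟨?_, inferInstance⟩, ?_⟩⟩
  · exact FactorsThrough.not_isAsplund (.comp_right _ (ContinuousLinearMap.id 𝕜 _))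
      (not_hasSeparableAdjointRange_bigSigma 𝕜 h𝒮)
  · intro X Y _ _ _ _ _ _ T hT
    exact factorsThrough_bigSigma_of_not_isAsplund hT 𝒮
  · intro X Y _ _ _ _ _ _ T hT _
    exact factorsThrough_smallSigma T hT 𝒮
  · exact FactorsThrough.not_isAsplund (.comp_right _ (ContinuousLinearMap.id 𝕜 _)) h
  · intro X Y _ _ _ _ _ _ T hT _
    exact factorsThrough_smallSigma T (not_hasSeparableAdjointRange_of_not_isAsplund hT) 𝒮

/-- The initial segment of length `n` of an infinite sequence. -/
def initialSegment (a : ℕ → Bool) (n : ℕ) : Omega :=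
  (List.range n).map fun i => (a i).toNat

theorem initialSegment_mem (h𝒮 : dyadicTree ≤ 𝒮) (a : ℕ → Bool) (n : ℕ) :
    initialSegment a n ∈ 𝒮 := by
  refine h𝒮 fun k hk => ?_
  obtain ⟨i, -, rfl⟩ := List.mem_map.1 hk
  cases a i <;> simp

theorem initialSegment_mono (a : ℕ → Bool) {m n : ℕ} (hmn : m ≤ n) :
    initialSegment a m ≤ initialSegment a n :=
  List.IsPrefix.map _ (by
    have := List.take_prefix m (List.range n)
    rwa [List.take_range, min_eq_left hmn] at this)

theorem length_initialSegment (a : ℕ → Bool) (n : ℕ) :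
    List.length (initialSegment a n) = n := by
  simp [initialSegment]

/-- The initial segments of each 0-1 sequence form a branch which determines the sequence, so
Cantor's theorem applies. -/
theorem not_countable_boundary (h𝒮 : dyadicTree ≤ 𝒮) : ¬ (boundary 𝒮).Countable := by
  let s : (ℕ → Bool) → ℕ → 𝒮 := fun a n => ⟨initialSegment a n, initialSegment_mem h𝒮 a n⟩
  have hlen : ∀ a n, List.length (s a n).1 = n := length_initialSegment
  have hinj : ∀ a, Function.Injective (s a) := fun a m n h => by
    rw [← hlen a m, h, hlen a n]
  have hmono : ∀ a m n, m ≤ n → s a m ≤ s a n := fun a m n h => initialSegment_mono a h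
  have hb : ∀ a, Set.range (s a) ∈ boundary 𝒮 := fun a => by
    refine ⟨⟨?_, fun C hC hsub => hsub.antisymm fun t ht => ?_⟩,
      Set.infinite_range_of_injective (hinj a)⟩
    · rintro _ ⟨m, rfl⟩ _ ⟨n, rfl⟩ -
      exact (le_total m n).imp (hmono a m n) (hmono a n m)
    -- Maximality: an element of a larger chain is comparable with the segment of its own length,
    -- hence equal to it.
    · refine ⟨List.length t.1, ?_⟩
      rcases hC.total ht (hsub ⟨List.length t.1, rfl⟩) with h | h
      · exact Subtype.ext (List.IsPrefix.eq_of_length h (hlen _ _).symm).symm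
      · exact Subtype.ext (List.IsPrefix.eq_of_length h (hlen _ _))
  let b : (ℕ → Bool) → boundary 𝒮 := fun a => ⟨_, hb a⟩
  have hbinj : Function.Injective b := fun a c hac => by
    have hac : Set.range (s a) = Set.range (s c) := congrArg Subtype.val hac
    funext i
    obtain ⟨n, hn⟩ : s a (i + 1) ∈ Set.range (s c) := hac ▸ ⟨_, rfl⟩
    have : n = i + 1 := by rw [← hlen c n, hn, hlen]
    subst this
    have h : initialSegment c (i + 1) = initialSegment a (i + 1) := congrArg Subtype.val hn
    have := List.map_inj_left.1 h i (by simp)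
    revert this
    cases a i <;> cases c i <;> simp
  intro hcount
  have : Countable (boundary 𝒮) := hcount.to_subtype
  have : Countable (ℕ → Bool) := hbinj.countable
  classical
  obtain ⟨f, hf⟩ := exists_injective_nat (ℕ → Bool)
  refine Function.cantor_injective (fun A : Set ℕ => f fun n => decide (n ∈ A)) fun A B hAB => ?_
  ext n
  simpa using congrFun (hf hAB) n

end Branches

end TreeOperators

theorem mainTheorem2 (𝕜 : Type w) [RCLike 𝕜] :
    (∀ (X : Type u) (Y : Type v)
        [NormedAddCommGroup X] [NormedSpace 𝕜 X] [CompleteSpace X]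
        [NormedAddCommGroup Y] [NormedSpace 𝕜 Y] [CompleteSpace Y]
        (T : X →L[𝕜] Y), ¬ HasSeparableAdjointRange T → ∀ 𝒯 : LowerSet Omega,
      (SeparableSpace X → FactorsThrough (bigSigma 𝕜 𝒯) T) ∧
      (SeparableSpace Y →
        FactorsThrough (smallSigma 𝕜 𝒯) T ∧ FactorsThrough (bigSigma 𝕜 𝒯) T)) ∧
    (∀ 𝒮 : LowerSet Omega, ¬ (boundary 𝒮).Countable →
      UniversalityFor.{w, u, v} 𝕜 𝒮) ∧
    (∀ (X : Type u) (Y : Type v)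
        [NormedAddCommGroup X] [NormedSpace 𝕜 X] [CompleteSpace X]
        [NormedAddCommGroup Y] [NormedSpace 𝕜 Y] [CompleteSpace Y]
        (T : X →L[𝕜] Y), SeparableSpace Y →
      (¬ HasSeparableAdjointRange T ↔ ¬ IsAsplund T)) ∧
    (¬ (boundary (⊤ : LowerSet Omega)).Countable ∧ UniversalityFor.{w, u, v} 𝕜 ⊤) ∧
    (¬ (boundary dyadicTree).Countable ∧ UniversalityFor.{w, u, v} 𝕜 dyadicTree) := by
  have htop : ¬ (boundary (⊤ : LowerSet Omega)).Countable := not_countable_boundary le_top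
  have hdyadic : ¬ (boundary dyadicTree).Countable := not_countable_boundary le_rfl
  refine ⟨?_, fun 𝒮 h𝒮 => universalityFor 𝕜 h𝒮, ?_, ⟨htop, universalityFor 𝕜 htop⟩,
    hdyadic, universalityFor 𝕜 hdyadic⟩
  · intro X Y _ _ _ _ _ _ T hT 𝒯
    refine ⟨fun _ => factorsThrough_bigSigma_of_separable_domain T hT 𝒯, fun _ => ?_⟩
    have h := factorsThrough_smallSigma T hT 𝒯
    exact ⟨h, (bigSigma_factorsThrough_smallSigma 𝒯).trans h⟩
  · intro X Y _ _ _ _ _ _ T _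
    -- `smallSigma` of the dyadic tree serves as a test operator: it has separable domain and
    -- non-separable adjoint range, and it factors through `T`.
    exact ⟨fun hT => (factorsThrough_smallSigma T hT dyadicTree).not_isAsplund
      (not_hasSeparableAdjointRange_smallSigma 𝕜 hdyadic),
      not_hasSeparableAdjointRange_of_not_isAsplund⟩
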